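/- Let $\zeta(s,v)$ denote the (analytically continued) Hurwitz zeta function, and for $0<v\le 1$ and $s\in\mathbb{C}$ let $\mathrm{B}(s,v)=-s\,\zeta(1-s,v)$ for $s\ne 0$ and $\mathrm{B}(0,v)=1$ (the generalized Bernoulli function). Put $$\mathrm{G}(s,v)=2^{s}\left(\mathrm{B}\!\left(s,\tfrac{v}{2}\right)-\mathrm{B}\!\left(s,\tfrac{v+1}{2}\right)\right),\qquad \mathrm{E}(s,v)=-\frac{\mathrm{G}(s+1,v)}{s+1}\quad(s\neq-1),$$ let $\mathrm{E}_\sigma(s)=2^{s}\,\mathrm{E}\!\left(s,\tfrac12\right)$ for $s\ne -1$ and $\mathrm{E}_\sigma(-1)=\pi/2$ (the Euler secant function), and let $\mathrm{E}_n=\mathrm{E}_\sigma(n)$ for integers $n\ge 0$. Then for every integer $n\ge 0$ the number $\mathrm{E}_{2n}$ is the classical Euler number of index $2n$, that is, the $2n$-th derivative of $1/\cosh t$ at $t=0$, and $$\mathrm{E}_{2n}=\frac{2\pi}{2n+1}\int_{0}^{\infty}\frac{(4zi+1)^{2n+1}-(4zi-1)^{2n+1}}{\left(e^{-\pi z}+e^{\pi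 z}\right)^{2}}\,dz ,$$ where the integral converges absolutely. -/

import Mathlib

namespace JensenEuler

/-- The generalized Bernoulli function `B(s, v) = -s ζ(1 - s, v)`, with the removable
singularity at `s = 0` filled in by `B(0, v) = 1`. Here `ζ(·, v)` is the analytically continued
Hurwitz zeta function, and the parameter is a real number `0 < v ≤ 1` (in this range the
Hurwitz zeta function agrees with Mathlib's, whose parameter is taken modulo `1`). -/
noncomputable def genBernoulli (s : ℂ) (v : ℝ) : ℂ :=
  if s = 0 then 1 else -s * HurwitzZeta.hurwitzZeta (v : UnitAddCircle) (1 - s)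

/-- The generalized Genocchi function
`G(s, v) = 2 ^ s (B(s, v / 2) - B(s, (v + 1) / 2))`, for `0 < v ≤ 1`. -/
noncomputable def genGenocchi (s : ℂ) (v : ℝ) : ℂ :=
  (2 : ℂ) ^ s * (genBernoulli s (v / 2) - genBernoulli s ((v + 1) / 2))

/-- The generalized Euler function `E(s, v) = -G(s + 1, v) / (s + 1)`,
for `s ≠ -1` and `0 < v ≤ 1`. -/
noncomputable def genEuler (s : ℂ) (v : ℝ) : ℂ :=
  -genGenocchi (s + 1) v / (s + 1)

/-- The Euler secant function `E_σ(s) = 2 ^ s E(s, 1 / 2)`, with the limiting value `π / 2`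
at `s = -1`. -/
noncomputable def eulerSecant (s : ℂ) : ℂ :=
  if s = -1 then (Real.pi : ℂ) / 2 else (2 : ℂ) ^ s * genEuler s (1 / 2)

/-- The Euler numbers `E_n = E_σ(n)`. -/
noncomputable def eulerNumber (n : ℕ) : ℂ := eulerSecant (n : ℂ)

/-- The classical Euler numbers, the coefficients in `1 / cosh t = ∑ E_n t ^ n / n!`. -/
noncomputable def classicalEulerNumber (n : ℕ) : ℝ :=
  iteratedDeriv n (fun t : ℝ => 1 / Real.cosh t) 0

end JensenEuler

open PowerSeries Finset Filter Topology MeasureTheory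
open scoped Nat

/-! Everything reduces to values of Bernoulli polynomials. The Hurwitz zeta difference defining the
Euler secant function at `n` is a multiple of B_{n+1}(1/4) - B_{n+1}(3/4)
(`hurwitzZeta_quarter_sub`). In the generating function of the Bernoulli polynomials with t replaced
by 4t, the same difference gives -2t sech t, which identifies the classical Euler numbers.

The value x = 1/2 gives 2t sech t after multiplication by e^t - e^{-t}, so Euler numbers are also
binomial sums of 4^k B_k(1/2). Expanding the integrand in powers of z produces the same sum, because
the even moments of the weight are multiples of B_{2j}(1/2) (`integral_pow_mul_sechSqWeight`):
expand the weight in exponentials, take Mellin transforms, and recognise the Fourier series of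
B_{2j} at 1/2. -/

/-! ### Generating series: sech and Bernoulli polynomials -/

/-- The exponential generating series `∑ f⁽ⁿ⁾(0) tⁿ / n!` of the derivatives of `f` at `0`. -/
noncomputable def taylorSeriesZero (f : ℝ → ℝ) : PowerSeries ℝ :=
  PowerSeries.mk fun n => iteratedDeriv n f 0 / n !

theorem taylorSeriesZero_mul {f g : ℝ → ℝ} (hf : ContDiff ℝ ⊤ f) (hg : ContDiff ℝ ⊤ g) :
    taylorSeriesZero (f * g) = taylorSeriesZero f * taylorSeriesZero g := by
  ext n
  rw [coeff_mul, taylorSeriesZero, coeff_mk, iteratedDeriv_mul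
    (hf.contDiffAt.of_le le_top) (hg.contDiffAt.of_le le_top), Finset.sum_div,
    Finset.Nat.sum_antidiagonal_eq_sum_range_succ_mk]
  refine Finset.sum_congr rfl fun k hk => ?_
  have hk' : k ≤ n := by simpa [Nat.lt_succ_iff] using hk
  simp only [taylorSeriesZero, coeff_mk]
  rw [Nat.cast_choose ℝ hk']
  field_simp

theorem two_mul_taylorSeriesZero_cosh :
    2 * taylorSeriesZero Real.cosh = rescale (1 : ℝ) (exp ℝ) + rescale (-1 : ℝ) (exp ℝ) := by
  ext n
  rw [show (2 : PowerSeries ℝ) = C 2 from rfl, coeff_C_mul]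
  rcases Nat.even_or_odd' n with ⟨k, rfl | rfl⟩
  · simp [taylorSeriesZero]; ring
  · simp [taylorSeriesZero, pow_succ]

theorem taylorSeriesZero_sech_mul :
    taylorSeriesZero (fun t => 1 / Real.cosh t) *
      (rescale (1 : ℝ) (exp ℝ) + rescale (-1 : ℝ) (exp ℝ)) = 2 := by
  have hsech : ContDiff ℝ ⊤ (fun t : ℝ => 1 / Real.cosh t) :=
    contDiff_const.div Real.contDiff_cosh fun x => (Real.cosh_pos x).ne'
  rw [← two_mul_taylorSeriesZero_cosh, mul_left_comm,
    ← taylorSeriesZero_mul hsech Real.contDiff_cosh]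
  have : ((fun t => 1 / Real.cosh t) * Real.cosh) = fun _ => (1 : ℝ) := by
    ext t; simp [(Real.cosh_pos t).ne']
  rw [this]
  convert mul_one (2 : PowerSeries ℝ)
  ext n
  simp [taylorSeriesZero, iteratedDeriv_const, coeff_one]
  aesop

/-- The series `∑ 4ⁿ Bₙ(x) tⁿ / n!`. -/
noncomputable def bernoulliSeriesFour (x : ℝ) : PowerSeries ℝ :=
  PowerSeries.mk fun n => 4 ^ n * (bernoulliFun n x / n !)

theorem bernoulliSeriesFour_mul (x : ℝ) :
    bernoulliSeriesFour x * (rescale (4 : ℝ) (exp ℝ) - 1) =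
      4 * X * rescale (4 * x) (exp ℝ) := by
  have h := congrArg (rescale (4 : ℝ)) (Polynomial.bernoulli_generating_function x)
  rw [map_mul, map_mul, map_sub, map_one, rescale_rescale, rescale_X, mul_comm x 4] at h
  rw [show (4 : PowerSeries ℝ) = C 4 from rfl, ← h]
  congr 1
  ext n
  rw [coeff_rescale, coeff_mk, bernoulliSeriesFour, coeff_mk, bernoulliFun,
    Polynomial.eval_map_algebraMap, map_smul, Rat.smul_def]
  push_cast
  ring

theorem rescale_exp_sub_one_ne_zero : rescale (4 : ℝ) (exp ℝ) - 1 ≠ 0 := by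
  intro h
  have := congrArg (coeff 1) h
  simp [coeff_one] at this

/-- Factoring the denominator of the Bernoulli series exposes 2 cosh t, which the sech series
inverts. -/
theorem rescale_exp_four_sub_one :
    rescale (4 : ℝ) (exp ℝ) - 1 = rescale (2 : ℝ) (exp ℝ) *
      (rescale (1 : ℝ) (exp ℝ) + rescale (-1 : ℝ) (exp ℝ)) *
      (rescale (1 : ℝ) (exp ℝ) - rescale (-1 : ℝ) (exp ℝ)) := by
  have h4 := exp_mul_exp_eq_exp_add (2 : ℝ) 2
  have h2 := exp_mul_exp_eq_exp_add (1 : ℝ) 1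
  have h0 := exp_mul_exp_eq_exp_add (1 : ℝ) (-1)
  norm_num at h4 h2 h0
  norm_num
  rw [← h4, ← h2]
  linear_combination (1 + exp ℝ * rescale (-1 : ℝ) (exp ℝ)) * h0

theorem bernoulliSeriesFour_quarter_sub :
    bernoulliSeriesFour (1 / 4) - bernoulliSeriesFour (3 / 4) =
      -2 * X * taylorSeriesZero (fun t => 1 / Real.cosh t) := by
  apply mul_right_cancel₀ rescale_exp_sub_one_ne_zero
  rw [sub_mul, bernoulliSeriesFour_mul, bernoulliSeriesFour_mul, rescale_exp_four_sub_one]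
  have h3 := exp_mul_exp_eq_exp_add (2 : ℝ) 1
  have h1 := exp_mul_exp_eq_exp_add (2 : ℝ) (-1)
  have hA := taylorSeriesZero_sech_mul
  norm_num at h3 h1 hA ⊢
  linear_combination 2 * X * rescale (2 : ℝ) (exp ℝ) *
    (exp ℝ - rescale (-1 : ℝ) (exp ℝ)) * hA + 4 * X * h3 - 4 * X * h1

/-- At x = 1/2 the numerator e^{2t} cancels the same factor of e^{4t} - 1. -/
theorem bernoulliSeriesFour_half_mul :
    bernoulliSeriesFour (1 / 2) * (rescale (1 : ℝ) (exp ℝ) - rescale (-1 : ℝ) (exp ℝ)) =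
      2 * X * taylorSeriesZero (fun t => 1 / Real.cosh t) := by
  apply mul_right_cancel₀ rescale_exp_sub_one_ne_zero
  rw [mul_right_comm, bernoulliSeriesFour_mul, rescale_exp_four_sub_one]
  have hA := taylorSeriesZero_sech_mul
  norm_num at hA ⊢
  linear_combination -2 * X * rescale (2 : ℝ) (exp ℝ) *
    (exp ℝ - rescale (-1 : ℝ) (exp ℝ)) * hA

theorem classicalEulerNumber_eq_bernoulliFun_quarter (n : ℕ) :
    JensenEuler.classicalEulerNumber n =
      -(4 ^ (n + 1) / (2 * (n + 1))) *
        (bernoulliFun (n + 1) (1 / 4) - bernoulliFun (n + 1) (3 / 4)) := by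
  have h := congrArg (coeff (n + 1)) bernoulliSeriesFour_quarter_sub
  rw [show (-2 : PowerSeries ℝ) = C (-2) by simp; rfl, mul_assoc, coeff_C_mul,
    coeff_succ_X_mul, map_sub] at h
  simp only [bernoulliSeriesFour, taylorSeriesZero, coeff_mk, Nat.factorial_succ] at h
  rw [JensenEuler.classicalEulerNumber]
  push_cast at h
  field_simp at h ⊢
  linear_combination h

theorem classicalEulerNumber_eq_sum_bernoulliFun_half (n : ℕ) :
    JensenEuler.classicalEulerNumber n =
      1 / (2 * (n + 1)) * ∑ k ∈ range (n + 2),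
        (n + 1).choose k * (4 ^ k * bernoulliFun k (1 / 2)) * (1 - (-1) ^ (n + 1 - k)) := by
  have h := congrArg (coeff (n + 1)) bernoulliSeriesFour_half_mul
  rw [show (2 : PowerSeries ℝ) = C 2 from rfl, mul_assoc, coeff_C_mul, coeff_succ_X_mul,
    coeff_mul, Finset.Nat.sum_antidiagonal_eq_sum_range_succ_mk] at h
  simp only [bernoulliSeriesFour, taylorSeriesZero, coeff_mk, map_sub, coeff_rescale] at h
  have h' : iteratedDeriv n (fun t => 1 / Real.cosh t) 0 = n ! / 2 * (2 * (iteratedDeriv n (fun t => 1 / Real.cosh t) 0 / n !)) := by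
    field_simp
  rw [JensenEuler.classicalEulerNumber, h', ← h, mul_sum, mul_sum]
  refine sum_congr rfl fun k hk => ?_
  have hk' : k ≤ n + 1 := by simpa [Nat.lt_succ_iff] using hk
  rw [Nat.cast_choose ℝ hk', coeff_exp, Nat.factorial_succ]
  push_cast
  field_simp
  simp

/-! ### The sine zeta function at 1/4 -/

theorem sin_pi_div_two_mul_odd (k : ℕ) :
    Real.sin (2 * Real.pi * (1 / 4 : ℝ) * ((2 * k + 1 : ℕ) : ℝ)) = (-1) ^ k := by
  rw [← Real.cos_nat_mul_pi, ← Real.sin_add_pi_div_two]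
  congr 1
  push_cast
  ring

theorem hasSum_sinZeta_quarter {s : ℝ} (hs : 1 < s) :
    HasSum (fun k : ℕ => (((-1) ^ k * (1 / (2 * k + 1 : ℝ) ^ s) : ℝ) : ℂ))
      (HurwitzZeta.sinZeta ((1 / 4 : ℝ) : UnitAddCircle) s) := by
  have h := HurwitzZeta.hasSum_nat_sinZeta (1 / 4) (s := s) (by simpa using hs)
  have hinj : Function.Injective fun k : ℕ => 2 * k + 1 := fun a b hab => by
    simpa using hab
  rw [← hinj.hasSum_iff] at h
  · refine h.congr_fun fun k => ?_
    simp only [Function.comp_apply]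
    rw [sin_pi_div_two_mul_odd, Complex.ofReal_mul, Complex.ofReal_div,
      Complex.ofReal_cpow (by positivity)]
    push_cast
    ring
  · intro m hm
    rcases Nat.even_or_odd' m with ⟨k, rfl | rfl⟩
    · rw [show 2 * Real.pi * (1 / 4 : ℝ) * ((2 * k : ℕ) : ℝ) = k * Real.pi by push_cast; ring,
        Real.sin_nat_mul_pi]
      simp
    · exact absurd ⟨k, rfl⟩ hm

theorem antitone_one_div_odd_rpow {s : ℝ} (hs : 0 ≤ s) :
    Antitone fun k : ℕ => 1 / (2 * k + 1 : ℝ) ^ s := by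
  intro a b hab
  have : (a : ℝ) ≤ b := by exact_mod_cast hab
  dsimp only
  gcongr

/-- Leibniz's series as a value of the analytically continued sine zeta function. -/
theorem sinZeta_quarter_one :
    HurwitzZeta.sinZeta ((1 / 4 : ℝ) : UnitAddCircle) 1 = (Real.pi : ℂ) / 4 := by
  have hcont : Tendsto (fun s : ℝ => HurwitzZeta.sinZeta ((1 / 4 : ℝ) : UnitAddCircle) (s : ℂ))
      (𝓝[>] 1) (𝓝 (HurwitzZeta.sinZeta ((1 / 4 : ℝ) : UnitAddCircle) 1)) := by
    have h := ((HurwitzZeta.differentiableAt_sinZeta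
      ((1 / 4 : ℝ) : UnitAddCircle)).continuous.comp Complex.continuous_ofReal).tendsto 1
    simp only [Function.comp_def, Complex.ofReal_one] at h
    exact h.mono_left nhdsWithin_le_nhds
  have hre := (Complex.continuous_re.tendsto _).comp hcont
  have him := (Complex.continuous_im.tendsto _).comp hcont
  have hpart (N : ℕ) : Tendsto
      (fun s : ℝ => ∑ k ∈ range N, (-1 : ℝ) ^ k * (1 / (2 * k + 1 : ℝ) ^ s)) (𝓝[>] 1)
      (𝓝 (∑ k ∈ range N, (-1 : ℝ) ^ k / (2 * k + 1))) := by
    have : Continuous fun s : ℝ => ∑ k ∈ range N, (-1 : ℝ) ^ k * (1 / (2 * k + 1 : ℝ) ^ s) := by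
      refine continuous_finsetSum _ fun k _ => continuous_const.mul
        (continuous_const.div (Real.continuous_const_rpow (by positivity)) fun s => by positivity)
    convert (this.tendsto 1).mono_left nhdsWithin_le_nhds using 2
    refine sum_congr rfl fun k _ => ?_
    rw [Real.rpow_one]
    ring
  have hsum {s : ℝ} (hs : 1 < s) := (Complex.hasSum_re (hasSum_sinZeta_quarter hs))
  simp only [Complex.ofReal_re] at hsum
  -- For s > 1 the alternating partial sums bracket the series; the bounds survive s → 1⁺, and then
  -- N → ∞ squeezes the value.
  have hlower (N : ℕ) : ∑ k ∈ range (2 * N), (-1 : ℝ) ^ k / (2 * k + 1) ≤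
      (HurwitzZeta.sinZeta ((1 / 4 : ℝ) : UnitAddCircle) 1).re := by
    refine le_of_tendsto_of_tendsto (hpart _) hre ?_
    filter_upwards [self_mem_nhdsWithin] with s hs
    exact (antitone_one_div_odd_rpow (zero_le_one.trans (le_of_lt hs))).alternating_series_le_tendsto
      (hsum hs).tendsto_sum_nat N
  have hupper (N : ℕ) : (HurwitzZeta.sinZeta ((1 / 4 : ℝ) : UnitAddCircle) 1).re ≤
      ∑ k ∈ range (2 * N + 1), (-1 : ℝ) ^ k / (2 * k + 1) := by
    refine le_of_tendsto_of_tendsto hre (hpart _) ?_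
    filter_upwards [self_mem_nhdsWithin] with s hs
    exact (antitone_one_div_odd_rpow (zero_le_one.trans (le_of_lt hs))).tendsto_le_alternating_series
      (hsum hs).tendsto_sum_nat N
  have h2 : Tendsto (fun N : ℕ => 2 * N) atTop atTop :=
    tendsto_atTop_mono (fun N => by simp only [id]; lia) tendsto_id
  have h21 : Tendsto (fun N : ℕ => 2 * N + 1) atTop atTop :=
    tendsto_atTop_mono (fun N => by simp only [id]; lia) tendsto_id
  apply Complex.ext
  · rw [show (Real.pi : ℂ) / 4 = ((Real.pi / 4 : ℝ) : ℂ) by push_cast; rfl, Complex.ofReal_re]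
    exact le_antisymm
      (ge_of_tendsto' (Real.tendsto_sum_pi_div_four.comp h21) hupper)
      (le_of_tendsto' (Real.tendsto_sum_pi_div_four.comp h2) hlower)
  · rw [show (Real.pi : ℂ) / 4 = ((Real.pi / 4 : ℝ) : ℂ) by push_cast; rfl, Complex.ofReal_im]
    refine tendsto_nhds_unique him (tendsto_const_nhds.congr' ?_)
    filter_upwards [self_mem_nhdsWithin] with s hs
    have h := Complex.hasSum_im (hasSum_sinZeta_quarter hs)
    simp only [Complex.ofReal_im] at h
    exact hasSum_zero.unique h

/-! ### Hurwitz zeta differences and the Euler secant function -/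

theorem coe_three_quarters :
    ((3 / 4 : ℝ) : UnitAddCircle) = -((1 / 4 : ℝ) : UnitAddCircle) := by
  rw [eq_neg_iff_add_eq_zero, ← AddCircle.coe_add]
  norm_num

/-- Since 3/4 = -1/4 on the circle, even parts cancel and odd parts double; the functional equation
turns the odd part at 0 into Leibniz's series. This covers the case k = 0, excluded from
`hurwitzZeta_neg_nat_eq_bernoulliFun`. -/
theorem hurwitzZeta_quarter_sub_zero :
    HurwitzZeta.hurwitzZeta ((1 / 4 : ℝ) : UnitAddCircle) 0 -
      HurwitzZeta.hurwitzZeta ((3 / 4 : ℝ) : UnitAddCircle) 0 = 1 / 2 := by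
  have h := HurwitzZeta.hurwitzZetaOdd_one_sub ((1 / 4 : ℝ) : UnitAddCircle) (s := 1)
    fun n hn => by
      have := congrArg Complex.re hn
      simp at this
      linarith [(Nat.cast_nonneg n : (0 : ℝ) ≤ n)]
  rw [sub_self, sinZeta_quarter_one, Complex.Gamma_one, mul_one, mul_one,
    Complex.sin_pi_div_two, Complex.cpow_neg_one] at h
  rw [coe_three_quarters, HurwitzZeta.hurwitzZeta, HurwitzZeta.hurwitzZeta,
    HurwitzZeta.hurwitzZetaEven_neg, HurwitzZeta.hurwitzZetaOdd_neg, h]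
  have := Complex.ofReal_ne_zero.mpr Real.pi_ne_zero
  field_simp
  norm_num

theorem hurwitzZeta_neg_nat_eq_bernoulliFun {k : ℕ} (hk : k ≠ 0) {x : ℝ}
    (hx : x ∈ Set.Icc (0 : ℝ) 1) :
    HurwitzZeta.hurwitzZeta (x : UnitAddCircle) (-k) =
      -1 / (k + 1) * (bernoulliFun (k + 1) x : ℂ) := by
  rw [HurwitzZeta.hurwitzZeta_neg_nat hk hx, bernoulliFun]
  have : (Polynomial.bernoulli (k + 1)).map (algebraMap ℚ ℂ) = _ :=
    (Polynomial.map_map (algebraMap ℚ ℝ) Complex.ofRealHom _).symm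
  rw [this, ← Complex.ofRealHom_eq_coe, Polynomial.eval_map_apply, Complex.ofRealHom_eq_coe]

theorem hurwitzZeta_quarter_sub (k : ℕ) :
    HurwitzZeta.hurwitzZeta ((1 / 4 : ℝ) : UnitAddCircle) (-k) -
      HurwitzZeta.hurwitzZeta ((3 / 4 : ℝ) : UnitAddCircle) (-k) =
      -1 / (k + 1) * ((bernoulliFun (k + 1) (1 / 4) - bernoulliFun (k + 1) (3 / 4) : ℝ) : ℂ) := by
  rcases eq_or_ne k 0 with rfl | hk
  · rw [Nat.cast_zero, neg_zero, hurwitzZeta_quarter_sub_zero]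
    simp [bernoulliFun_one]
    norm_num
  · rw [hurwitzZeta_neg_nat_eq_bernoulliFun hk (by norm_num),
      hurwitzZeta_neg_nat_eq_bernoulliFun hk (by norm_num)]
    push_cast
    ring

theorem eulerNumber_eq_bernoulliFun_quarter (n : ℕ) :
    JensenEuler.eulerNumber n =
      ((-(2 ^ (2 * n + 1) / (n + 1)) *
        (bernoulliFun (n + 1) (1 / 4) - bernoulliFun (n + 1) (3 / 4)) : ℝ) : ℂ) := by
  have hn1 : (n : ℂ) + 1 ≠ 0 := Nat.cast_add_one_ne_zero n
  have hn : (n : ℂ) ≠ -1 := fun h => hn1 (by rw [h]; ring)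
  have h := hurwitzZeta_quarter_sub n
  rw [JensenEuler.eulerNumber, JensenEuler.eulerSecant, if_neg hn, JensenEuler.genEuler,
    JensenEuler.genGenocchi, JensenEuler.genBernoulli, JensenEuler.genBernoulli, if_neg hn1,
    if_neg hn1, show (1 / 2 / 2 : ℝ) = 1 / 4 by norm_num,
    show ((1 / 2 + 1) / 2 : ℝ) = 3 / 4 by norm_num, show (1 - (n + 1 : ℂ)) = -n by ring,
    ← mul_sub, h, ← Nat.cast_add_one, Complex.cpow_natCast, Complex.cpow_natCast]
  push_cast
  field_simp
  ring

theorem eulerNumber_eq_classicalEulerNumber (n : ℕ) :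
    JensenEuler.eulerNumber n = (JensenEuler.classicalEulerNumber n : ℂ) := by
  rw [eulerNumber_eq_bernoulliFun_quarter, classicalEulerNumber_eq_bernoulliFun_quarter]
  congr 2
  rw [show (4 : ℝ) = 2 ^ 2 by norm_num, ← pow_mul]
  field_simp
  ring

/-! ### Moments of the weight -/

/-- The weight `(e^{-πz} + e^{πz})⁻²`. -/
noncomputable def sechSqWeight (z : ℝ) : ℝ :=
  1 / (Real.exp (-Real.pi * z) + Real.exp (Real.pi * z)) ^ 2

theorem sechSqWeight_eq (z : ℝ) :
    sechSqWeight z = Real.exp (-(2 * Real.pi) * z) / (1 + Real.exp (-(2 * Real.pi) * z)) ^ 2 := by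
  have h : Real.exp (-(2 * Real.pi) * z) = Real.exp (-Real.pi * z) * Real.exp (-Real.pi * z) := by
    rw [← Real.exp_add]; ring_nf
  have h1 : Real.exp (-Real.pi * z) * Real.exp (Real.pi * z) = 1 := by
    rw [← Real.exp_add]; simp
  have h2 : Real.exp (Real.pi * z) = (Real.exp (-Real.pi * z))⁻¹ := eq_inv_of_mul_eq_one_right h1
  have := Real.exp_pos (-Real.pi * z)
  rw [sechSqWeight, h, h2]
  field_simp
  ring

theorem sechSqWeight_nonneg (z : ℝ) : 0 ≤ sechSqWeight z := by
  rw [sechSqWeight]; positivity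

theorem continuous_sechSqWeight : Continuous sechSqWeight := by
  unfold sechSqWeight
  exact continuous_const.div (by fun_prop) fun z => by positivity

theorem sechSqWeight_le (z : ℝ) : sechSqWeight z ≤ Real.exp (-(2 * Real.pi) * z) := by
  rw [sechSqWeight_eq]
  refine div_le_self (Real.exp_pos _).le (one_le_pow₀ ?_)
  linarith [Real.exp_pos (-(2 * Real.pi) * z)]

theorem integrableOn_pow_mul_sechSqWeight (k : ℕ) :
    IntegrableOn (fun z : ℝ => z ^ k * sechSqWeight z) (Set.Ioi 0) := by
  have h := integrableOn_rpow_mul_exp_neg_mul_rpow (p := 1) (s := k) (b := 2 * Real.pi)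
    (by linarith [(Nat.cast_nonneg k : (0 : ℝ) ≤ k)]) one_pos (by positivity)
  refine Integrable.mono' h
    ((continuous_pow k).mul continuous_sechSqWeight).aestronglyMeasurable ?_
  filter_upwards [ae_restrict_mem measurableSet_Ioi] with z hz
  have hz : 0 < z := hz
  have := sechSqWeight_nonneg z
  rw [Real.norm_of_nonneg (by positivity), Real.rpow_natCast, Real.rpow_one]
  gcongr
  exact sechSqWeight_le z

theorem integral_sechSqWeight : ∫ z in Set.Ioi 0, sechSqWeight z = 1 / (4 * Real.pi) := by
  have hderiv (z : ℝ) : HasDerivAt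
      (fun z => -(1 / (2 * Real.pi)) * (1 + Real.exp (2 * Real.pi * z))⁻¹) (sechSqWeight z) z := by
    have h1 : HasDerivAt (fun z => 1 + Real.exp (2 * Real.pi * z))
        (Real.exp (2 * Real.pi * z) * (2 * Real.pi * 1)) z :=
      (((hasDerivAt_id z).const_mul (2 * Real.pi)).exp).const_add 1
    have hpos : 1 + Real.exp (2 * Real.pi * z) ≠ 0 := by positivity
    convert! (h1.inv hpos).const_mul (-(1 / (2 * Real.pi))) using 1
    have := Real.exp_pos (2 * Real.pi * z)
    rw [sechSqWeight_eq, neg_mul, Real.exp_neg]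
    field_simp
    ring
  have hlim : Tendsto (fun z => -(1 / (2 * Real.pi)) * (1 + Real.exp (2 * Real.pi * z))⁻¹) atTop
      (𝓝 0) := by
    rw [← mul_zero (-(1 / (2 * Real.pi)))]
    refine Tendsto.const_mul _ (tendsto_inv_atTop_zero.comp ?_)
    exact tendsto_atTop_add_const_left _ _
      (Real.tendsto_exp_atTop.comp (tendsto_id.const_mul_atTop (by positivity)))
  rw [integral_Ioi_of_hasDerivAt_of_nonneg' (fun z _ => hderiv z)
    (fun z _ => sechSqWeight_nonneg z) hlim]
  simp
  field_simp
  norm_num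

/-- This is ∑ n rⁿ = r / (1 - r)² at r = -e^{-2πz}, negated. -/
theorem hasSum_sechSqWeight {z : ℝ} (hz : 0 < z) :
    HasSum (fun n : ℕ => (((-1) ^ (n + 1) * n : ℝ) : ℂ) * (Real.exp (-(2 * Real.pi * n) * z) : ℂ))
      (sechSqWeight z : ℂ) := by
  have hr : ‖-Real.exp (-(2 * Real.pi) * z)‖ < 1 := by
    rw [norm_neg, Real.norm_of_nonneg (Real.exp_pos _).le, Real.exp_lt_one_iff]
    have := Real.pi_pos
    nlinarith [mul_pos this hz]
  have h := (hasSum_coe_mul_geometric_of_norm_lt_one hr).neg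
  have h' : HasSum (fun n : ℕ => ((-1) ^ (n + 1) * n : ℝ) * Real.exp (-(2 * Real.pi * n) * z))
      (sechSqWeight z) := by
    convert! h using 1
    · ext n
      rw [neg_pow (Real.exp _), ← Real.exp_nat_mul]
      ring_nf
    · rw [sechSqWeight_eq]
      ring
  exact_mod_cast Complex.hasSum_ofReal.mpr h'

theorem summable_moment_coeff {j : ℕ} (hj : j ≠ 0) :
    Summable fun n : ℕ => ‖(((-1) ^ (n + 1) * n : ℝ) : ℂ)‖ /
      (2 * Real.pi * n) ^ (2 * j + 1 : ℂ).re := by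
  have h : Summable fun n : ℕ => 1 / (2 * Real.pi) ^ (2 * j + 1) * (1 / (n : ℝ) ^ (2 * j)) :=
    (Real.summable_one_div_nat_pow.mpr (by lia)).mul_left _
  refine h.congr fun n => ?_
  have hre : (2 * j + 1 : ℂ).re = ((2 * j + 1 : ℕ) : ℝ) := by simp
  rw [hre, Real.rpow_natCast, Complex.norm_real, norm_mul, norm_pow, norm_neg, norm_one, one_pow,
    Real.norm_natCast]
  rcases eq_or_ne n 0 with rfl | hn
  · simp [hj]
  · have : (n : ℝ) ≠ 0 := by exact_mod_cast hn
    field_simp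
    ring

theorem integral_pow_mul_sechSqWeight (j : ℕ) :
    ∫ z in Set.Ioi 0, z ^ (2 * j) * sechSqWeight z =
      (-1) ^ j / (4 * Real.pi) * bernoulliFun (2 * j) (1 / 2) := by
  -- The Mellin series converges absolutely only for j ≠ 0, its terms having size n^{-2j}; the
  -- zeroth moment comes from an explicit antiderivative.
  rcases eq_or_ne j 0 with rfl | hj
  · simp [integral_sechSqWeight]
  have hm := hasSum_mellin (s := 2 * j + 1) (p := fun n : ℕ => 2 * Real.pi * n)
    (a := fun n : ℕ => (((-1) ^ (n + 1) * n : ℝ) : ℂ)) (F := fun z => (sechSqWeight z : ℂ))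
    (fun n => by
      -- The term n = 0 has zero exponent but also zero coefficient.
      rcases eq_or_ne n 0 with rfl | hn
      · simp
      · right; positivity)
    (by simp; positivity) (fun z hz => hasSum_sechSqWeight hz) (summable_moment_coeff hj)
  have hmellin : mellin (fun z => (sechSqWeight z : ℂ)) (2 * j + 1) =
      ((∫ z in Set.Ioi 0, z ^ (2 * j) * sechSqWeight z : ℝ) : ℂ) := by
    rw [mellin, ← integral_complex_ofReal]
    refine setIntegral_congr_fun measurableSet_Ioi fun z _ => ?_
    rw [add_sub_cancel_right, show (2 * j : ℂ) = ((2 * j : ℕ) : ℂ) by push_cast; rfl,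
      Complex.cpow_natCast, smul_eq_mul]
    push_cast
    rfl
  rw [hmellin] at hm
  have hc := (hasSum_one_div_nat_pow_mul_cos hj (x := 1 / 2) (by norm_num)).mul_left
    (-((2 * j)! : ℝ) / (2 * Real.pi) ^ (2 * j + 1))
  have hc' := Complex.hasSum_ofReal.mpr hc
  have hterm (n : ℕ) : Complex.Gamma (2 * j + 1) * (((-1) ^ (n + 1) * n : ℝ) : ℂ) /
      ((2 * Real.pi * n : ℝ) : ℂ) ^ (2 * j + 1 : ℂ) =
      ((-((2 * j)! : ℝ) / (2 * Real.pi) ^ (2 * j + 1) *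
        (1 / (n : ℝ) ^ (2 * j) * Real.cos (2 * Real.pi * n * (1 / 2))) : ℝ) : ℂ) := by
    rw [show (2 * j + 1 : ℂ) = ((2 * j : ℕ) : ℂ) + 1 by push_cast; rfl,
      Complex.Gamma_nat_eq_factorial, ← Nat.cast_add_one, Complex.cpow_natCast,
      show 2 * Real.pi * n * (1 / 2) = n * Real.pi by ring, Real.cos_nat_mul_pi]
    rcases eq_or_ne n 0 with rfl | hn
    · simp [hj]
    · have : (n : ℂ) ≠ 0 := by exact_mod_cast hn
      have := Complex.ofReal_ne_zero.mpr Real.pi_ne_zero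
      push_cast
      field_simp
      ring
  simp_rw [hterm] at hm
  rw [Complex.ofReal_injective (hm.unique hc'), bernoulliFun]
  have := Real.pi_ne_zero
  field_simp
  ring

/-! ### Expansion and integration of the integrand -/

theorem add_one_pow_sub_sub_one_pow {R : Type*} [CommRing R] (x : R) (N : ℕ) :
    (x + 1) ^ N - (x - 1) ^ N =
      ∑ k ∈ range (N + 1), N.choose k * (1 - (-1) ^ (N - k)) * x ^ k := by
  rw [sub_eq_add_neg x 1, add_pow, add_pow, ← sum_sub_distrib]
  refine sum_congr rfl fun k _ => ?_
  rw [one_pow]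
  ring

theorem secant_integrand_eq (N : ℕ) (z : ℝ) :
    ((4 * (z : ℂ) * Complex.I + 1) ^ N - (4 * (z : ℂ) * Complex.I - 1) ^ N) /
        (Complex.exp (-(Real.pi : ℂ) * (z : ℂ)) + Complex.exp ((Real.pi : ℂ) * (z : ℂ))) ^ 2 =
      ∑ k ∈ range (N + 1), N.choose k * (1 - (-1) ^ (N - k)) * (4 * Complex.I) ^ k *
        ((z ^ k * sechSqWeight z : ℝ) : ℂ) := by
  rw [add_one_pow_sub_sub_one_pow, sum_div]
  refine sum_congr rfl fun k _ => ?_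
  rw [sechSqWeight]
  push_cast
  ring

theorem integrableOn_secant_integrand_term (N k : ℕ) :
    IntegrableOn (fun z : ℝ => N.choose k * (1 - (-1) ^ (N - k)) * (4 * Complex.I) ^ k *
      ((z ^ k * sechSqWeight z : ℝ) : ℂ)) (Set.Ioi 0) :=
  (integrableOn_pow_mul_sechSqWeight k).ofReal.const_mul _

theorem integral_secant_integrand_term (n k : ℕ) (hk : k ≤ 2 * n + 1) :
    ∫ z in Set.Ioi (0 : ℝ), ((2 * n + 1).choose k : ℂ) * (1 - (-1) ^ (2 * n + 1 - k)) *
      (4 * Complex.I) ^ k * ((z ^ k * sechSqWeight z : ℝ) : ℂ) =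
    ((1 / (4 * Real.pi) * ((2 * n + 1).choose k * (4 ^ k * bernoulliFun k (1 / 2)) *
      (1 - (-1) ^ (2 * n + 1 - k))) : ℝ) : ℂ) := by
  rw [integral_const_mul, integral_complex_ofReal]
  rcases Nat.even_or_odd' k with ⟨j, rfl | rfl⟩
  · have hI : (4 * Complex.I) ^ (2 * j) = 4 ^ (2 * j) * (-1) ^ j := by
      rw [mul_pow, pow_mul Complex.I, Complex.I_sq]
    -- The sign from i^{2j} cancels the sign of the moment.
    have hsq : ((-1 : ℂ) ^ j) ^ 2 = 1 := by rw [← pow_mul, mul_comm, pow_mul]; simp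
    rw [integral_pow_mul_sechSqWeight, hI]
    push_cast
    linear_combination ((2 * n + 1).choose (2 * j) : ℂ) * (1 - (-1) ^ (2 * n + 1 - 2 * j)) *
      4 ^ (2 * j) / (4 * Real.pi) * (bernoulliFun (2 * j) (1 / 2) : ℂ) * hsq
  -- For odd k the binomial factor vanishes, so odd moments are never evaluated.
  · have : 2 * n + 1 - (2 * j + 1) = 2 * (n - j) := by lia
    rw [this, pow_mul, pow_mul]
    simp

theorem mainTheorem6 (n : ℕ) :
    JensenEuler.eulerNumber (2 * n) = (JensenEuler.classicalEulerNumber (2 * n) : ℂ) ∧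
    MeasureTheory.IntegrableOn
      (fun z : ℝ =>
        ((4 * (z : ℂ) * Complex.I + 1) ^ (2 * n + 1)
            - (4 * (z : ℂ) * Complex.I - 1) ^ (2 * n + 1))
          / (Complex.exp (-(Real.pi : ℂ) * (z : ℂ)) + Complex.exp ((Real.pi : ℂ) * (z : ℂ))) ^ 2)
      (Set.Ioi (0 : ℝ)) MeasureTheory.volume ∧
    JensenEuler.eulerNumber (2 * n) =
      2 * (Real.pi : ℂ) / (2 * (n : ℂ) + 1) *
        ∫ z : ℝ in Set.Ioi (0 : ℝ),
          ((4 * (z : ℂ) * Complex.I + 1) ^ (2 * n + 1)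
              - (4 * (z : ℂ) * Complex.I - 1) ^ (2 * n + 1))
            / (Complex.exp (-(Real.pi : ℂ) * (z : ℂ))
                + Complex.exp ((Real.pi : ℂ) * (z : ℂ))) ^ 2 := by
  refine ⟨eulerNumber_eq_classicalEulerNumber _, ?_, ?_⟩
  · simp_rw [secant_integrand_eq]
    exact integrable_finsetSum _ fun k _ => integrableOn_secant_integrand_term _ k
  · simp_rw [secant_integrand_eq]
    rw [integral_finsetSum _ fun k _ => integrableOn_secant_integrand_term _ k,
      sum_congr rfl fun k hk => integral_secant_integrand_term n k
        (Nat.lt_succ_iff.mp (mem_range.mp hk)), ← Complex.ofReal_sum, ← mul_sum,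
      eulerNumber_eq_classicalEulerNumber, classicalEulerNumber_eq_sum_bernoulliFun_half]
    have := Complex.ofReal_ne_zero.mpr Real.pi_ne_zero
    have : (2 * n + 1 : ℂ) ≠ 0 := by exact_mod_cast (2 * n).succ_ne_zero
    simp only [Complex.ofReal_mul, Complex.ofReal_div, Complex.ofReal_one, Complex.ofReal_ofNat,
      Complex.ofReal_add, Complex.ofReal_natCast, Nat.cast_mul, Nat.cast_ofNat]
    field_simp
    norm_num
    ring
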